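/- Let $X$ be a separable real Banach space that is (isometrically) the dual of a Banach space $X_*$, let $S\subset\mathbb R^d$ be non-empty and compact, and let $J\colon X\times S\to[0,+\infty]$ be Borel measurable and such that (H1) for every $s\in S$ the function $J(\cdot,s)$ is proper, convex and positively one-homogeneous, i.e. $J(\lambda v,s)=\lambda J(v,s)$ for all $\lambda\ge 0$, $v\in X$ (with $0\cdot\infty=0$); (H2) $J$ is sequentially lower semicontinuous on $X\times S$, where $X$ carries the weak* topology induced by $X_*$; (H3) there is a constant $C_0>0$ with $\|v\|_X\le C_0\,J(v,s)$ for all $v\in X$, $s\in S$. Let $\mathcal M(S;X)$ be the vector space of countably additive $X$-valued Borel measures $\mu$ on $S$ of finite variation, that is, with $|\mu|(S)<\infty$, where $|\mu|(E)=\sup\{\sum_{i=1}^n\|\mu(A_i)\|_X : n\in\mathbb N,\ (A_i)_{i=1}^n \text{ a Borel partition of } E\}$, and put $\|\mu\|_{\mathcal M}=|\mu|(S)$. Then every $\mu\in\mathcal M(S;X)$ has a density $\frac{\mu}{|\mu|}\in L^1((S,|\mu|);X)$, i.e. $\mu(E)=\int_E\frac{\mu}{|\mu|}\,d|\mu|$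 (Bochner integral) for all Borel $E\subset S$; it is unique $|\mu|$-a.e., and the functional $$\hat F\colon\mathcal M(S;X)\to[0,+\infty],\qquad \hat F(\mu)=\int_S J\Big(\frac{\mu}{|\mu|}(s),s\Big)\,d|\mu|(s),$$ has the following properties: 1. $\hat F$ is convex; 2. $\hat F$ is positively one-homogeneous: $\hat F(\lambda\mu)=\lambda\hat F(\mu)$ for all $\lambda\ge0$ and $\mu\in\mathcal M(S;X)$ (with $0\cdot\infty=0$); 3. $\hat F$ is coercive: there exists $C>0$ such that $\hat F(\mu)\ge C\|\mu\|_{\mathcal M}$ for all $\mu\in\mathcal M(S;X)$; 4. if $\mu,\nu\in\mathcal M(S;X)$ are such that $|\mu|$ and $|\nu|$ are mutually singular, then $\hat F(\mu+\nu)=\hat F(\mu)+\hat F(\nu)$. -/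

import Mathlib

open MeasureTheory Filter Topology
open scoped ENNReal NNReal

noncomputable section

/-- `𝓜(S; X)`: the vector space of countably additive `X`-valued measures on `S` with finite
(total) variation, where the variation is the supremum of `∑ i, ‖μ (A i)‖` over finite measurable
partitions. -/
def radonMeasures (S X : Type*) [MeasurableSpace S] [NormedAddCommGroup X] [NormedSpace ℝ X] :
    Submodule ℝ (VectorMeasure S X) where
  carrier := {μ | μ.variation Set.univ < ∞}
  zero_mem' := by simp
  add_mem' := by
    intro μ ν hμ hν
    exact (VectorMeasure.variation_add_le (μ := μ) (ν := ν) Set.univ).trans_lt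
      (ENNReal.add_lt_top.2 ⟨hμ, hν⟩)
  smul_mem' := by
    intro c μ hμ
    have h : (c • μ).variation Set.univ = (‖c‖₊ : ℝ≥0∞) * μ.variation Set.univ := by
      rw [VectorMeasure.variation_smul]
      rfl
    exact h.trans_lt (ENNReal.mul_lt_top ENNReal.coe_lt_top hμ)

section

variable {S X : Type*} [MeasurableSpace S] [NormedAddCommGroup X] [NormedSpace ℝ X]

/-- The variation measure `|μ|`. -/
def totalVar (μ : radonMeasures S X) : Measure S := (μ : VectorMeasure S X).variation

instance (μ : radonMeasures S X) : IsFiniteMeasure (totalVar μ) := ⟨μ.2⟩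

/-- The total variation norm `‖μ‖ = |μ|(S)`. -/
def tvNorm (μ : radonMeasures S X) : ℝ := (totalVar μ).real Set.univ

/-- `u` is a density `μ / |μ|`: it is Bochner integrable with respect to `|μ|` and
`μ E = ∫_E u d|μ|` for every measurable `E`. -/
def IsDensity (μ : radonMeasures S X) (u : S → X) : Prop :=
  Integrable u (totalVar μ) ∧
    ∀ E : Set S, MeasurableSet E → (μ : VectorMeasure S X) E = ∫ s in E, u s ∂(totalVar μ)

open Classical in
/-- The density `μ / |μ|`, unique up to `|μ|`-null sets (see `IsDensity.ae_eq`); the value is the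
junk function `0` if there is no density. -/
def density (μ : radonMeasures S X) : S → X :=
  if h : ∃ u, IsDensity μ u then h.choose else 0

/-- The lifted functional `μ ↦ ∫ J ((μ / |μ|) s, s) d|μ|`. -/
def liftedFunctional (J : X → S → ℝ≥0∞) (μ : radonMeasures S X) : ℝ≥0∞ :=
  ∫⁻ s, J (density μ s) s ∂(totalVar μ)

theorem isDensity_density {μ : radonMeasures S X} (h : ∃ u, IsDensity μ u) :
    IsDensity μ (density μ) := by
  rw [density, dif_pos h]
  exact h.choose_spec

theorem IsDensity.ae_eq [CompleteSpace X] {μ : radonMeasures S X} {u v : S → X}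
    (hu : IsDensity μ u) (hv : IsDensity μ v) : u =ᵐ[totalVar μ] v :=
  Integrable.ae_eq_of_forall_setIntegral_eq u v hu.1 hv.1
    fun E hE _ => (hu.2 E hE).symm.trans (hv.2 E hE)

/-- The lifted functional can be computed with any density. -/
theorem liftedFunctional_eq [CompleteSpace X] (J : X → S → ℝ≥0∞) {μ : radonMeasures S X}
    {u : S → X} (hu : IsDensity μ u) :
    liftedFunctional J μ = ∫⁻ s, J (u s) s ∂(totalVar μ) := by
  refine lintegral_congr_ae ?_
  filter_upwards [(isDensity_density ⟨u, hu⟩).ae_eq hu] with s hs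
  rw [hs]

end

end

/-! Existence of densities is the Radon-Nikodym property of separable duals
(`exists_bochner_density`): differentiate the scalar measures `e (μ ·) p` for `p` in a countable
dense subgroup of the predual, then reassemble the derivatives at almost every point into one
functional. The functional is handled by changing the reference measure: homogeneity of `J` absorbs
the factor `d|μ|/dm`, so any finite `m ≫ |μ|` computes it (`liftedFunctional_eq_lintegral`). With `m
= |μ| + |ν|`, pointwise sublinearity of `J` gives convexity, and disjoint supports give additivity.
-/

/-! ### Radon-Nikodym property of separable duals -/

/-- Vectors `p n` that half-norm a dense sequence `x n` of functionals have dense span: a nonzero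
`f` killing every `p n`, with `‖f - x n‖ < ‖f‖ / 4`, would give `‖x n‖ < ‖f‖ / 2`, hence `‖f‖ < 3‖f‖
/ 4`. -/
theorem separableSpace_of_separableSpace_strongDual (P : Type*) [NormedAddCommGroup P]
    [NormedSpace ℝ P] [TopologicalSpace.SeparableSpace (StrongDual ℝ P)] :
    TopologicalSpace.SeparableSpace P := by
  let x := TopologicalSpace.denseSeq (StrongDual ℝ P)
  have hp : ∀ n, ∃ p : P, ‖p‖ ≤ 1 ∧ ‖x n‖ / 2 ≤ ‖x n p‖ := by
    intro n
    rcases eq_or_ne (x n) 0 with h | h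
    · exact ⟨0, by simp, by simp [h]⟩
    · obtain ⟨p, hp, hlt⟩ := (x n).exists_lt_apply_of_lt_opNorm (half_lt_self (norm_pos_iff.2 h))
      exact ⟨p, hp.le, hlt.le⟩
  choose p hp1 hp2 using hp
  have key : (Submodule.span ℝ (Set.range p)).topologicalClosure = ⊤ := by
    rw [Submodule.eq_top_iff']
    intro q
    by_contra hq
    obtain ⟨f, c, hf, hfq⟩ := geometric_hahn_banach_closed_point
      (Submodule.convex (Submodule.span ℝ (Set.range p)).topologicalClosure)
      (Submodule.isClosed_topologicalClosure _) hq
    have hc : 0 < c := by simpa using hf 0 (Submodule.zero_mem _)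
    have hf0 : ∀ n, f (p n) = 0 := by
      intro n
      by_contra hne
      -- This multiple lies in the subspace, where `f < c`, yet `f` equals `c` on it.
      have := hf ((c / f (p n)) • p n) (Submodule.smul_mem _ _
        (Submodule.le_topologicalClosure _ (Submodule.subset_span ⟨n, rfl⟩)))
      rw [map_smul, smul_eq_mul, div_mul_cancel₀ _ hne] at this
      exact this.false
    have hfne : 0 < ‖f‖ := by
      rw [norm_pos_iff]
      rintro rfl
      simp only [zero_apply] at hfq
      linarith
    obtain ⟨n, hn⟩ := (TopologicalSpace.denseRange_denseSeq (StrongDual ℝ P)).exists_dist_lt f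
      (show 0 < ‖f‖ / 4 by positivity)
    rw [dist_eq_norm] at hn
    have h1 : ‖x n (p n)‖ ≤ ‖f - x n‖ := by
      have := (f - x n).le_opNorm (p n)
      rw [sub_apply, hf0, zero_sub, norm_neg] at this
      exact this.trans (mul_le_of_le_one_right (norm_nonneg _) (hp1 n))
    have h2 : ‖f‖ ≤ ‖f - x n‖ + ‖x n‖ := by simpa using norm_add_le (f - x n) (x n)
    have := hp2 n
    linarith
  have hsep : TopologicalSpace.IsSeparable (Set.univ : Set P) := by
    have := (Set.countable_range p).isSeparable.span (R := ℝ) |>.closure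
    rwa [← Submodule.topologicalClosure_coe, key] at this
  exact TopologicalSpace.isSeparable_univ_iff.1 hsep

/-- Integer scalars keep the span countable; they suffice because continuous additive maps are real
linear. -/
theorem exists_dense_countable_intSubmodule (P : Type*) [NormedAddCommGroup P]
    [TopologicalSpace.SeparableSpace P] :
    ∃ D : Submodule ℤ P, Countable D ∧ Dense (D : Set P) :=
  ⟨Submodule.span ℤ (Set.range (TopologicalSpace.denseSeq P)), inferInstance,
    (TopologicalSpace.denseRange_denseSeq P).mono Submodule.subset_span⟩

theorem exists_strongDual_extension {P : Type*} [NormedAddCommGroup P] [NormedSpace ℝ P]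
    {D : Submodule ℤ P} (hD : Dense (D : Set P)) (g : D → ℝ)
    (hadd : ∀ p q, g (p + q) = g p + g q) (hg : ∀ p : D, ‖g p‖ ≤ ‖(p : P)‖) :
    ∃ f : StrongDual ℝ P, ‖f‖ ≤ 1 ∧ ∀ p : D, f p = g p := by
  let g₀ : D →+ ℝ := AddMonoidHom.mk' g hadd
  have hg₀ : Continuous g₀ :=
    AddMonoidHomClass.continuous_of_bound g₀ 1 fun p => by
      rw [one_mul]
      exact hg p
  let g₁ : D →L[ℤ] ℝ := ⟨g₀.toIntLinearMap, hg₀⟩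
  let i : D →L[ℤ] P := ⟨D.subtype, continuous_subtype_val⟩
  have hi : DenseRange i := hD.denseRange_val
  have hiu : IsUniformInducing i := isUniformEmbedding_subtype_val.isUniformInducing
  let f₀ : P →L[ℤ] ℝ := g₁.extend i
  have hf₀ : ∀ p : D, f₀ p = g p := fun p => ContinuousLinearMap.extend_eq g₁ hi hiu p
  let f : StrongDual ℝ P := AddMonoidHom.toRealLinearMap (f₀ : P →+ ℝ) f₀.continuous
  refine ⟨f, f.opNorm_le_bound zero_le_one fun p => ?_, hf₀⟩
  refine hD.induction (P := fun p => ‖f p‖ ≤ 1 * ‖p‖) (fun p hp => ?_)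
    (isClosed_le (by fun_prop) (by fun_prop)) p
  rw [one_mul]
  exact (congrArg norm (hf₀ ⟨p, hp⟩)).trans_le (hg ⟨p, hp⟩)

theorem exists_bounded_real_density {S : Type*} [MeasurableSpace S] (m : Measure S)
    [IsFiniteMeasure m] (ν : SignedMeasure S) (C : ℝ)
    (h : ∀ E, MeasurableSet E → |ν E| ≤ C * m.real E) :
    ∃ g : S → ℝ, Measurable g ∧ Integrable g m ∧ (∀ᵐ s ∂m, |g s| ≤ C) ∧
      ∀ E, MeasurableSet E → ν E = ∫ s in E, g s ∂m := by
  have hac : ν ≪ᵥ m.toENNRealVectorMeasure := by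
    refine VectorMeasure.AbsolutelyContinuous.mk fun E hE hmE => ?_
    rw [Measure.toENNRealVectorMeasure_apply_measurable hE] at hmE
    have := h E hE
    rw [measureReal_def, hmE, ENNReal.toReal_zero, mul_zero] at this
    exact abs_nonpos_iff.1 this
  have hint := SignedMeasure.integrable_rnDeriv ν m
  have heq : ∀ E, MeasurableSet E → ν E = ∫ s in E, ν.rnDeriv m s ∂m := by
    intro E hE
    conv_lhs => rw [← SignedMeasure.withDensityᵥ_rnDeriv_eq ν m hac]
    exact withDensityᵥ_apply hint hE
  refine ⟨ν.rnDeriv m, SignedMeasure.measurable_rnDeriv ν m, hint, ?_, heq⟩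
  have h1 : ν.rnDeriv m ≤ᵐ[m] fun _ => C := by
    refine ae_le_of_forall_setIntegral_le hint (integrable_const C) fun E hE _ => ?_
    rw [← heq E hE, setIntegral_const, smul_eq_mul, mul_comm]
    exact (abs_le.1 (h E hE)).2
  have h2 : (fun _ => -C) ≤ᵐ[m] ν.rnDeriv m := by
    refine ae_le_of_forall_setIntegral_le (integrable_const _) hint fun E hE _ => ?_
    rw [← heq E hE, setIntegral_const, smul_eq_mul, mul_comm, neg_mul]
    exact (abs_le.1 (h E hE)).1
  filter_upwards [h1, h2] with s hs1 hs2 using abs_le.2 ⟨hs2, hs1⟩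

/-- The Dunford-Pettis theorem: separable dual spaces have the Radon-Nikodym property. -/
theorem exists_bochner_density {P X S : Type*} [NormedAddCommGroup P] [NormedSpace ℝ P]
    [NormedAddCommGroup X] [NormedSpace ℝ X] [CompleteSpace X]
    [TopologicalSpace.SeparableSpace X] (e : X ≃ₗᵢ[ℝ] StrongDual ℝ P)
    [MeasurableSpace S] (m : Measure S) [IsFiniteMeasure m] (μ : VectorMeasure S X)
    (h : ∀ E, MeasurableSet E → ‖μ E‖ ≤ m.real E) :
    ∃ u : S → X, Integrable u m ∧ ∀ E, MeasurableSet E → μ E = ∫ s in E, u s ∂m := by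
  have : TopologicalSpace.SeparableSpace (StrongDual ℝ P) :=
    e.surjective.denseRange.separableSpace e.continuous
  have := separableSpace_of_separableSpace_strongDual P
  obtain ⟨D, hDc, hD⟩ := exists_dense_countable_intSubmodule P
  let ev : P → X →L[ℝ] ℝ := fun p =>
    (ContinuousLinearMap.apply ℝ ℝ p).comp (e : X →L[ℝ] StrongDual ℝ P)
  have hev : ∀ p x, ev p x = e x p := fun p x => rfl
  let ν : P → SignedMeasure S := fun p => μ.mapRange (ev p : X →+ ℝ) (ev p).continuous
  have hν : ∀ p E, ν p E = e (μ E) p := fun p E => rfl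
  have hνle : ∀ p E, MeasurableSet E → |ν p E| ≤ ‖p‖ * m.real E := by
    intro p E hE
    calc |ν p E| ≤ ‖e (μ E)‖ * ‖p‖ := (e (μ E)).le_opNorm p
      _ ≤ ‖p‖ * m.real E := by
        rw [e.norm_map, mul_comm]
        exact mul_le_mul_of_nonneg_left (h E hE) (norm_nonneg p)
  choose g hgm hgi hgb hgE using fun p => exists_bounded_real_density m (ν p) ‖p‖ (hνle p)
  have hgadd : ∀ p q, ∀ᵐ s ∂m, g (p + q) s = g p s + g q s := by
    intro p q
    refine Integrable.ae_eq_of_forall_setIntegral_eq _ _ (hgi _) ((hgi p).add (hgi q))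
      fun E hE _ => ?_
    rw [← hgE _ E hE, integral_add (hgi p).integrableOn (hgi q).integrableOn, ← hgE _ E hE,
      ← hgE _ E hE, hν, hν, hν, map_add]
  have hae : ∀ᵐ s ∂m, (∀ p q : D, g (p + q) s = g p s + g q s) ∧ ∀ p : D, |g p s| ≤ ‖(p : P)‖ :=
    (ae_all_iff.2 fun p : D => ae_all_iff.2 fun q : D => hgadd p q).and
      (ae_all_iff.2 fun p : D => hgb p)
  -- Countability of `D` puts all the relations in one conull set; off it the value is `0`.
  have hex : ∀ s, ∃ x : X, ((∀ p q : D, g (p + q) s = g p s + g q s) ∧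
      ∀ p : D, |g p s| ≤ ‖(p : P)‖) → ‖x‖ ≤ 1 ∧ ∀ p : D, e x p = g p s := by
    intro s
    by_cases hs : (∀ p q : D, g (p + q) s = g p s + g q s) ∧ ∀ p : D, |g p s| ≤ ‖(p : P)‖
    · obtain ⟨f, hf1, hf2⟩ := exists_strongDual_extension hD (fun p : D => g p s)
        (fun p q => hs.1 p q) hs.2
      exact ⟨e.symm f, fun _ => ⟨by simpa using hf1, by simpa using hf2⟩⟩
    · exact ⟨0, fun h => (hs h).elim⟩
  choose u hu using hex
  have hu' : ∀ᵐ s ∂m, ‖u s‖ ≤ 1 ∧ ∀ p : D, e (u s) p = g p s := hae.mono fun s hs => hu s hs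
  borelize X
  have hinj : ∀ x y : X, (∀ p : D, e x p = e y p) → x = y := fun x y hxy =>
    e.injective (DFunLike.coe_injective
      (Continuous.ext_on hD (e x).continuous (e y).continuous fun p hp => hxy ⟨p, hp⟩))
  let Φ : X → D → ℝ := fun x p => ev p x
  -- Lusin-Souslin: `X` is Polish and `D` countable, so the pointwise choice `u` is a.e. measurable
  -- once its coordinates are.
  have hΦ : MeasurableEmbedding Φ :=
    (measurable_pi_lambda _ fun p : D => (ev p).continuous.measurable).measurableEmbedding
      fun x y hxy => hinj x y fun p => congrFun hxy p
  have hum : AEMeasurable u m := by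
    refine hΦ.aemeasurable_comp_iff.1 ⟨fun s p => g p s, measurable_pi_lambda _ fun p => hgm p, ?_⟩
    filter_upwards [hu'] with s hs using funext fun p => hs.2 p
  have hui : Integrable u m :=
    Integrable.of_bound hum.aestronglyMeasurable 1 (hu'.mono fun s hs => hs.1)
  refine ⟨u, hui, fun E hE => hinj _ _ fun p => ?_⟩
  calc e (μ E) p = ∫ s in E, g p s ∂m := hgE p E hE
    _ = ∫ s in E, ev p (u s) ∂m :=
      integral_congr_ae (ae_restrict_of_ae (hu'.mono fun s hs => (hs.2 p).symm))
    _ = ev p (∫ s in E, u s ∂m) := (ev p).integral_comp_comm hui.integrableOn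

/-! ### Change of reference measure and the lifted functional -/

theorem aemeasurable_integrand {S X : Type*} [MeasurableSpace S] [NormedAddCommGroup X]
    [MeasurableSpace X] [BorelSpace X] {J : X → S → ℝ≥0∞}
    (hJ : Measurable fun p : X × S => J p.1 p.2)
    {m : Measure S} {f : S → X} (hf : Integrable f m) : AEMeasurable (fun s => J (f s) s) m :=
  hJ.comp_aemeasurable (hf.aemeasurable.prodMk aemeasurable_id)

section
variable {S X : Type*} [MeasurableSpace S] [NormedAddCommGroup X] [NormedSpace ℝ X]

theorem totalVar_absolutelyContinuous {μ : radonMeasures S X} {m : Measure S} {f : S → X}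
    (hμ : ∀ E, MeasurableSet E → (μ : VectorMeasure S X) E = ∫ s in E, f s ∂m) :
    totalVar μ ≪ m := by
  refine Measure.AbsolutelyContinuous.mk fun E hE hmE => ?_
  refine (VectorMeasure.variation_apply_eq_zero hE).2 fun t htE ht => ?_
  rw [hμ t ht, Measure.restrict_eq_zero.2 (measure_mono_null htE hmE), integral_zero_measure]

theorem IsDensity.rnDeriv_smul_ae_eq [CompleteSpace X] {μ : radonMeasures S X} {u : S → X}
    (hu : IsDensity μ u) {m : Measure S} [IsFiniteMeasure m] {f : S → X} (hf : Integrable f m)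
    (hμ : ∀ E, MeasurableSet E → (μ : VectorMeasure S X) E = ∫ s in E, f s ∂m) :
    (fun s => ((totalVar μ).rnDeriv m s).toReal • u s) =ᵐ[m] f := by
  have hac := totalVar_absolutelyContinuous hμ
  have hint := (integrable_rnDeriv_smul_iff hac).2 hu.1
  refine Integrable.ae_eq_of_forall_setIntegral_eq _ _ hint hf fun E hE _ => ?_
  rw [← hμ E hE, hu.2 E hE, ← withDensityᵥ_apply hint hE, withDensityᵥ_rnDeriv_smul hac hu.1,
    withDensityᵥ_apply hu.1 hE]

theorem exists_common_density [CompleteSpace X] {μ : radonMeasures S X}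
    (hμ : ∃ u, IsDensity μ u) {m : Measure S} [IsFiniteMeasure m] (hm : totalVar μ ≪ m) :
    ∃ f : S → X, Integrable f m ∧
      ∀ E, MeasurableSet E → (μ : VectorMeasure S X) E = ∫ s in E, f s ∂m := by
  obtain ⟨u, hu⟩ := hμ
  have hint := (integrable_rnDeriv_smul_iff hm).2 hu.1
  refine ⟨_, hint, fun E hE => ?_⟩
  rw [hu.2 E hE, ← withDensityᵥ_apply hint hE, withDensityᵥ_rnDeriv_smul hm hu.1,
    withDensityᵥ_apply hu.1 hE]

theorem ae_eq_zero_restrict_of_null [CompleteSpace X] {μ : radonMeasures S X} {m : Measure S}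
    {f : S → X} (hf : Integrable f m)
    (hμ : ∀ E, MeasurableSet E → (μ : VectorMeasure S X) E = ∫ s in E, f s ∂m)
    {N : Set S} (hN : MeasurableSet N) (h0 : totalVar μ N = 0) : ∀ᵐ s ∂m, s ∈ N → f s = 0 := by
  rw [← ae_restrict_iff' hN]
  refine Integrable.ae_eq_zero_of_forall_setIntegral_eq_zero hf.integrableOn fun E hE _ => ?_
  rw [Measure.restrict_restrict hE, ← hμ _ (hE.inter hN)]
  exact (VectorMeasure.variation_apply_eq_zero hN).1 h0 _ Set.inter_subset_right (hE.inter hN)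

/-- This inequality is all that coercivity needs; `‖u‖ = 1` a.e. is not required. -/
theorem totalVar_univ_le_lintegral_enorm {μ : radonMeasures S X} {u : S → X}
    (hu : IsDensity μ u) : totalVar μ Set.univ ≤ ∫⁻ s, ‖u s‖ₑ ∂(totalVar μ) := by
  rw [← setLIntegral_univ, ← withDensity_apply _ MeasurableSet.univ]
  refine VectorMeasure.variation_le_of_forall_enorm_le (fun E hE => ?_) Set.univ
  rw [withDensity_apply _ hE, hu.2 E hE]
  exact enorm_integral_le_lintegral_enorm _

variable [MeasurableSpace X] [BorelSpace X]
  {J : X → S → ℝ≥0∞}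

/-- The lifted functional can be computed with respect to any reference measure. -/
theorem liftedFunctional_eq_lintegral [CompleteSpace X]
    (hJ : Measurable fun p : X × S => J p.1 p.2)
    (hhom : ∀ (s : S) (c : ℝ≥0) (v : X), J (c • v) s = c * J v s)
    {μ : radonMeasures S X} (hμd : ∃ u, IsDensity μ u) {m : Measure S} [IsFiniteMeasure m]
    {f : S → X} (hf : Integrable f m)
    (hμ : ∀ E, MeasurableSet E → (μ : VectorMeasure S X) E = ∫ s in E, f s ∂m) :
    liftedFunctional J μ = ∫⁻ s, J (f s) s ∂m := by
  obtain ⟨u, hu⟩ := hμd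
  have hac := totalVar_absolutelyContinuous hμ
  have hmeas := aemeasurable_integrand hJ hu.1
  rw [← Measure.withDensity_rnDeriv_eq _ _ hac] at hmeas
  rw [liftedFunctional_eq J hu]
  conv_lhs => rw [← Measure.withDensity_rnDeriv_eq _ _ hac]
  rw [lintegral_withDensity_eq_lintegral_mul₀' (Measure.measurable_rnDeriv _ _).aemeasurable hmeas]
  refine lintegral_congr_ae ?_
  filter_upwards [hu.rnDeriv_smul_ae_eq hf hμ, Measure.rnDeriv_lt_top (totalVar μ) m]
    with s hs hlt
  rw [Pi.mul_apply, ← hs]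
  -- The derivative is finite a.e., so it is an admissible factor in the homogeneity of `J`.
  have := hhom s ((totalVar μ).rnDeriv m s).toNNReal (u s)
  rw [ENNReal.coe_toNNReal hlt.ne] at this
  exact this.symm

/-- Two measures have densities with respect to the sum of their variations, and these compute the
lifted functional of each and of their sum. -/
theorem exists_densities_add [CompleteSpace X]
    (hJ : Measurable fun p : X × S => J p.1 p.2)
    (hhom : ∀ (s : S) (c : ℝ≥0) (v : X), J (c • v) s = c * J v s)
    (hd : ∀ μ : radonMeasures S X, ∃ u, IsDensity μ u) (μ ν : radonMeasures S X) :
    ∃ f g : S → X, Integrable f (totalVar μ + totalVar ν) ∧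
      Integrable g (totalVar μ + totalVar ν) ∧
      (∀ E, MeasurableSet E →
        (μ : VectorMeasure S X) E = ∫ s in E, f s ∂(totalVar μ + totalVar ν)) ∧
      (∀ E, MeasurableSet E →
        (ν : VectorMeasure S X) E = ∫ s in E, g s ∂(totalVar μ + totalVar ν)) ∧
      liftedFunctional J μ = ∫⁻ s, J (f s) s ∂(totalVar μ + totalVar ν) ∧
      liftedFunctional J ν = ∫⁻ s, J (g s) s ∂(totalVar μ + totalVar ν) ∧
      liftedFunctional J (μ + ν) = ∫⁻ s, J (f s + g s) s ∂(totalVar μ + totalVar ν) := by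
  obtain ⟨f, hf, hfE⟩ := exists_common_density (hd μ) (m := totalVar μ + totalVar ν)
    (Measure.le_add_right le_rfl).absolutelyContinuous
  obtain ⟨g, hg, hgE⟩ := exists_common_density (hd ν) (m := totalVar μ + totalVar ν)
    (Measure.le_add_left le_rfl).absolutelyContinuous
  refine ⟨f, g, hf, hg, hfE, hgE, liftedFunctional_eq_lintegral hJ hhom (hd μ) hf hfE,
    liftedFunctional_eq_lintegral hJ hhom (hd ν) hg hgE,
    liftedFunctional_eq_lintegral hJ hhom (hd _) (hf.add hg) fun E hE => ?_⟩
  rw [integral_add hf.integrableOn hg.integrableOn, ← hfE E hE, ← hgE E hE]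
  rfl

theorem liftedFunctional_add_le [CompleteSpace X]
    (hJ : Measurable fun p : X × S => J p.1 p.2)
    (hhom : ∀ (s : S) (c : ℝ≥0) (v : X), J (c • v) s = c * J v s)
    (hsub : ∀ s v w, J (v + w) s ≤ J v s + J w s)
    (hd : ∀ μ : radonMeasures S X, ∃ u, IsDensity μ u) (μ ν : radonMeasures S X) :
    liftedFunctional J (μ + ν) ≤ liftedFunctional J μ + liftedFunctional J ν := by
  obtain ⟨f, g, hf, hg, -, -, h1, h2, h3⟩ := exists_densities_add hJ hhom hd μ ν
  rw [h1, h2, h3, ← lintegral_add_left' (aemeasurable_integrand hJ hf)]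
  exact lintegral_mono fun s => hsub s _ _

theorem liftedFunctional_smul [CompleteSpace X]
    (hJ : Measurable fun p : X × S => J p.1 p.2)
    (hhom : ∀ (s : S) (c : ℝ≥0) (v : X), J (c • v) s = c * J v s)
    (hd : ∀ μ : radonMeasures S X, ∃ u, IsDensity μ u) (c : ℝ≥0) (μ : radonMeasures S X) :
    liftedFunctional J (c • μ) = c * liftedFunctional J μ := by
  obtain ⟨u, hu⟩ := hd μ
  rw [liftedFunctional_eq_lintegral hJ hhom (hd _) (m := totalVar μ) (f := fun s => c • u s)
      (hu.1.smul (c : ℝ)), liftedFunctional_eq J hu,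
    ← lintegral_const_mul'' _ (aemeasurable_integrand hJ hu.1)]
  · simp_rw [hhom]
  · intro E hE
    refine .trans ?_ (integral_smul (c : ℝ) _).symm
    rw [← hu.2 E hE]
    rfl

theorem liftedFunctional_add_of_mutuallySingular [CompleteSpace X]
    (hJ : Measurable fun p : X × S => J p.1 p.2)
    (hhom : ∀ (s : S) (c : ℝ≥0) (v : X), J (c • v) s = c * J v s)
    (hd : ∀ μ : radonMeasures S X, ∃ u, IsDensity μ u) {μ ν : radonMeasures S X}
    (h : totalVar μ ⟂ₘ totalVar ν) :
    liftedFunctional J (μ + ν) = liftedFunctional J μ + liftedFunctional J ν := by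
  obtain ⟨f, g, hf, hg, hfE, hgE, h1, h2, h3⟩ := exists_densities_add hJ hhom hd μ ν
  rw [h1, h2, h3, ← lintegral_add_left' (aemeasurable_integrand hJ hf)]
  have hJ0 : ∀ s, J 0 s = 0 := fun s => by simpa using hhom s 0 0
  refine lintegral_congr_ae ?_
  filter_upwards [ae_eq_zero_restrict_of_null hf hfE h.measurableSet_nullSet h.measure_nullSet,
    ae_eq_zero_restrict_of_null hg hgE h.measurableSet_nullSet.compl h.measure_compl_nullSet]
    with s hs1 hs2
  -- `f` vanishes a.e. on the `|μ|`-null set and `g` a.e. off it, so one summand is always zero.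
  by_cases hs : s ∈ h.nullSet
  · simp [hs1 hs, hJ0]
  · simp [hs2 hs, hJ0]

theorem ofReal_tvNorm_le_liftedFunctional [CompleteSpace X]
    (hJ : Measurable fun p : X × S => J p.1 p.2)
    (hd : ∀ μ : radonMeasures S X, ∃ u, IsDensity μ u)
    {C : ℝ} (hC : 0 < C) (hcoer : ∀ v s, ENNReal.ofReal ‖v‖ ≤ ENNReal.ofReal C * J v s)
    (μ : radonMeasures S X) :
    ENNReal.ofReal (C⁻¹ * tvNorm μ) ≤ liftedFunctional J μ := by
  obtain ⟨u, hu⟩ := hd μ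
  have h1 : totalVar μ Set.univ ≤ ENNReal.ofReal C * liftedFunctional J μ := by
    rw [liftedFunctional_eq J hu, ← lintegral_const_mul'' _ (aemeasurable_integrand hJ hu.1)]
    refine (totalVar_univ_le_lintegral_enorm hu).trans (lintegral_mono fun s => ?_)
    rw [← ofReal_norm]
    exact hcoer _ _
  rw [ENNReal.ofReal_mul (inv_nonneg.2 hC.le), ENNReal.ofReal_inv_of_pos hC, tvNorm,
    ofReal_measureReal, mul_comm, ← div_eq_mul_inv]
  exact ENNReal.div_le_of_le_mul' h1
end

theorem subadditive_of_convexOn_of_homogeneous {X : Type*} [NormedAddCommGroup X]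
    [NormedSpace ℝ X] {F : X → ℝ≥0∞} (hconv : ConvexOn ℝ≥0 Set.univ F)
    (hhom : ∀ (c : ℝ≥0) (v : X), F (c • v) = c * F v) (v w : X) : F (v + w) ≤ F v + F w := by
  -- `v + w` is the midpoint of `2v` and `2w`.
  have h := hconv.2 (Set.mem_univ ((2 : ℝ≥0) • v)) (Set.mem_univ ((2 : ℝ≥0) • w))
    (zero_le (a := (2⁻¹ : ℝ≥0))) (zero_le (a := (2⁻¹ : ℝ≥0)))
    (by rw [← two_mul]; exact mul_inv_cancel₀ two_ne_zero)
  have h2 : ∀ a : ℝ≥0∞, (2⁻¹ : ℝ≥0) • (((2 : ℝ≥0) : ℝ≥0∞) * a) = a := fun a => by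
    rw [ENNReal.smul_def, smul_eq_mul, ← mul_assoc, ← ENNReal.coe_mul, inv_mul_cancel₀ two_ne_zero,
      ENNReal.coe_one, one_mul]
  rwa [inv_smul_smul₀ two_ne_zero, inv_smul_smul₀ two_ne_zero, hhom, hhom, h2, h2] at h

theorem mainTheorem7
    {P X : Type*}
    [NormedAddCommGroup P] [NormedSpace ℝ P] [CompleteSpace P]
    [NormedAddCommGroup X] [NormedSpace ℝ X] [CompleteSpace X]
    [TopologicalSpace.SeparableSpace X] [MeasurableSpace X] [BorelSpace X]
    -- `P` is a predual of `X`
    (e : X ≃ₗᵢ[ℝ] StrongDual ℝ P)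
    {d : ℕ} (S : Set (EuclideanSpace ℝ (Fin d))) (hSne : S.Nonempty) (hS : IsCompact S)
    (J : X → S → ℝ≥0∞)
    (hJmeas : Measurable fun p : X × S => J p.1 p.2)
    (hJproper : ∀ s, ∃ v, J v s ≠ ∞)
    (hJconv : ∀ s, ConvexOn ℝ≥0 Set.univ fun v => J v s)
    (hJhom : ∀ (s : S) (c : ℝ≥0) (v : X), J (c • v) s = c * J v s)
    -- sequential lower semicontinuity for the weak* topology on `X`
    (hJlsc : ∀ (v : ℕ → X) (v₀ : X) (s : ℕ → S) (s₀ : S),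
      Tendsto (fun n => StrongDual.toWeakDual (e (v n))) atTop
        (𝓝 (StrongDual.toWeakDual (e v₀))) →
      Tendsto s atTop (𝓝 s₀) →
      J v₀ s₀ ≤ liminf (fun n => J (v n) (s n)) atTop)
    (hJcoer : ∃ C : ℝ, 0 < C ∧ ∀ v s, ENNReal.ofReal ‖v‖ ≤ ENNReal.ofReal C * J v s) :
    -- every measure has an (a.e. unique) density with respect to its variation
    (∀ μ : radonMeasures S X, ∃ u, IsDensity μ u ∧ ∀ w, IsDensity μ w → w =ᵐ[totalVar μ] u) ∧
    ConvexOn ℝ≥0 Set.univ (liftedFunctional J) ∧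
    (∀ (c : ℝ≥0) (μ : radonMeasures S X),
      liftedFunctional J (c • μ) = c * liftedFunctional J μ) ∧
    (∃ C : ℝ, 0 < C ∧ ∀ μ : radonMeasures S X,
      ENNReal.ofReal (C * tvNorm μ) ≤ liftedFunctional J μ) ∧
    (∀ μ ν : radonMeasures S X, totalVar μ ⟂ₘ totalVar ν →
      liftedFunctional J (μ + ν) = liftedFunctional J μ + liftedFunctional J ν) := by
  have hd : ∀ μ : radonMeasures S X, ∃ u, IsDensity μ u := fun μ =>
    exists_bochner_density e (totalVar μ) μ fun E _ =>
      VectorMeasure.norm_measure_le_variation (measure_ne_top (totalVar μ) E)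
  have hsub : ∀ s v w, J (v + w) s ≤ J v s + J w s := fun s =>
    subadditive_of_convexOn_of_homogeneous (hJconv s) (hJhom s)
  have hsmul := liftedFunctional_smul hJmeas hJhom hd
  refine ⟨fun μ => ?_, ⟨convex_univ, fun μ _ ν _ a b _ _ _ => ?_⟩, hsmul, ?_,
    fun μ ν => liftedFunctional_add_of_mutuallySingular hJmeas hJhom hd⟩
  · obtain ⟨u, hu⟩ := hd μ
    exact ⟨u, hu, fun w hw => hw.ae_eq hu⟩
  · refine (liftedFunctional_add_le hJmeas hJhom hsub hd _ _).trans_eq ?_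
    rw [hsmul, hsmul]
    rfl
  · obtain ⟨C, hC, hcoer⟩ := hJcoer
    exact ⟨C⁻¹, inv_pos.2 hC, ofReal_tvNorm_le_liftedFunctional hJmeas hd hC hcoer⟩
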